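/- Let $R$ be a (commutative, unital) $f$-ring, i.e. a lattice-ordered ring with $(a\wedge b)c=ac\wedge bc$ for all $a,b\in R$ and all $c\ge 0$, and let $S=R^+=\{a\in R\mid a\ge 0\}$ be its positive cone, a commutative semiring; assume that $S$ is reduced, i.e. that $0$ is its only nilpotent element. Let $(L_S,\mathfrak{D})$ be a support of $S$: $L_S$ is a bounded distributive lattice and $\mathfrak{D}\colon S\to L_S$ is a map such that $L_S$ is generated as a bounded lattice by $\{\mathfrak{D}(s)\mid s\in S\}$ and, for all $a,b,b_1,\dots,b_n\in S$: $\mathfrak{D}(0)=0$ and $\mathfrak{D}(1)=1$; $\mathfrak{D}(a+b)\le\mathfrak{D}(a)\vee\mathfrak{D}(b)$; $\mathfrak{D}(ab)=\mathfrak{D}(a)\wedge\mathfrak{D}(b)$; and $\mathfrak{D}(a)\le\mathfrak{D}(b_1)\vee\cdots\vee\mathfrak{D}(b_n)$ implies that some power of $a$ lies in the ideal $\langle b_1,\dots,b_n\rangle$. Then the following are equivalent. 1. The set $\mathsf{Spec}(S)$ of all prime ideals of $S$, with the Zariski topology, is a Stone space (compact, Hausdorff and totally disconnected). 2. $L_S$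 is a Boolean algebra. 3. $S$ is a (von Neumann) regular semiring: for every $a\in S$ there is $b\in S$ with $a=a^2b$. 4. The frame $\mathsf{RId}(S)$ of radical ideals of $S$, ordered by inclusion, is zero-dimensional, i.e. each of its elements is a join of complemented elements. 5. Every prime ideal of $S$ is a maximal ideal. -/

import Mathlib

/-- An `f`-ring (commutative, with `1`): a lattice-ordered ring in which multiplication by
nonnegative elements distributes over binary meets. -/
class IsFRing (R : Type*) [CommRing R] [Lattice R] : Prop extends IsOrderedRing R where
  inf_mul_of_nonneg : ∀ a b c : R, 0 ≤ c → (a ⊓ b) * c = a * c ⊓ b * c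

/-- The positive cone of an ordered ring; for an ordered ring it carries Mathlib's
commutative semiring structure on the nonnegative elements. -/
abbrev PositiveCone (R : Type*) [CommRing R] [Lattice R] : Type _ := {x : R // 0 ≤ x}

/-- A support of a commutative semiring `S` on a bounded distributive lattice `L`. -/
structure IsSupport {S L : Type*} [CommSemiring S] [DistribLattice L] [BoundedOrder L]
    (D : S → L) : Prop where
  /-- `L` is generated, as a (bounded) lattice, by the elements `D s`:
  the only sublattice containing all of them is `L` itself;
  note that `⊥ = D 0` and `⊤ = D 1` are among the generators. -/
  generates : ∀ M : Sublattice L, (∀ s, D s ∈ M) → M = ⊤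
  map_zero : D 0 = ⊥
  map_one : D 1 = ⊤
  map_add_le : ∀ a b : S, D (a + b) ≤ D a ⊔ D b
  map_mul : ∀ a b : S, D (a * b) = D a ⊓ D b
  mem_radical : ∀ (a : S) (t : Finset S),
    D a ≤ t.sup D → a ∈ (Ideal.span (t : Set S)).radical

/-- The radical ideals of a commutative semiring, ordered by inclusion. -/
def RId (S : Type*) [CommSemiring S] : Type _ := {I : Ideal S // I.IsRadical}

namespace RId

variable {S : Type*} [CommSemiring S]

instance : PartialOrder (RId S) := inferInstanceAs (PartialOrder {I : Ideal S // I.IsRadical})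

/-- The radical of an ideal, as a radical ideal. -/
def ofIdeal (I : Ideal S) : RId S := ⟨I.radical, I.radical_isRadical⟩

/-- Taking radicals is left adjoint to the inclusion of radical ideals into all ideals. -/
def gi : GaloisInsertion (ofIdeal (S := S)) (fun I : RId S => I.1) where
  choice I hI := ⟨I, hI⟩
  gc _ J := J.2.radical_le_iff
  le_l_u _ := Ideal.le_radical
  choice_eq _ hI := Subtype.ext (le_antisymm Ideal.le_radical hI)

/-- Joins in `RId S` are radicals of sums of ideals, meets are intersections. -/
instance : CompleteLattice (RId S) := gi.liftCompleteLattice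

theorem coe_sup (I J : RId S) : (I ⊔ J).1 = (I.1 ⊔ J.1).radical := rfl

theorem coe_inf (I J : RId S) : (I ⊓ J).1 = I.1 ⊓ J.1 := rfl

theorem coe_sSup (A : Set (RId S)) :
    (sSup A).1 = (sSup ((fun I : RId S => I.1) '' A)).radical := rfl

theorem inf_sSup_le (I : RId S) (A : Set (RId S)) : I ⊓ sSup A ≤ ⨆ J ∈ A, I ⊓ J := by
  rintro x ⟨hxI, hxA⟩
  obtain ⟨n, hn⟩ : x ∈ (sSup ((fun I : RId S => I.1) '' A)).radical := hxA
  have key : I.1 * sSup ((fun I : RId S => I.1) '' A) ≤ (⨆ J ∈ A, I ⊓ J : RId S).1 := by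
    rw [sSup_image, Ideal.mul_iSup]
    refine iSup_le fun J => ?_
    rw [Ideal.mul_iSup]
    refine iSup_le fun hJ => ?_
    have h : I ⊓ J ≤ ⨆ J ∈ A, I ⊓ J := le_iSup₂_of_le J hJ le_rfl
    exact Ideal.mul_le_inf.trans h
  refine (⨆ J ∈ A, I ⊓ J : RId S).2 ⟨n + 1, key ?_⟩
  rw [pow_succ']
  exact Ideal.mul_mem_mul hxI hn

instance : Order.Frame (RId S) := Order.Frame.ofMinimalAxioms ⟨inf_sSup_le⟩

end RId

/-- A frame is zero-dimensional if every element is a join of complemented elements. -/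
def IsZeroDimensionalFrame (F : Type*) [Order.Frame F] : Prop :=
  ∀ x : F, ∃ C : Set F, (∀ c ∈ C, IsComplemented c) ∧ x = sSup C

/-- A Stone space: compact, Hausdorff and totally disconnected. -/
def IsStoneSpace (X : Type*) [TopologicalSpace X] : Prop :=
  CompactSpace X ∧ T2Space X ∧ TotallyDisconnectedSpace X

/-- A (von Neumann) regular commutative semiring. -/
def IsRegularSemiring (S : Type*) [CommSemiring S] : Prop :=
  ∀ a : S, ∃ b : S, a = a ^ 2 * b

/-!
Every condition says that each principal ideal `(a)` of `S` is complemented by an annihilator: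
there are `b` and `c` with `a * c = 0` and `a * b + c = 1`. Such a pair splits `D a`, the basic open
set of `a` and the radical of `(a)` alike, which gives the Boolean, Stone and zero-dimensionality
conditions. Conversely, in a reduced semiring an ideal complementary to `(a)` modulo nilpotents
annihilates `a` on the nose.

Regularity `a = a ^ 2 * b` only provides the idempotent `a * b`; it gives such a `c` as soon as
idempotents of `S` have complements. In a ring the complement of `e` is `1 - e`, and in an `f`-ring
squares are nonnegative, so that `1 - e = (1 - e) ^ 2` lies in the positive cone whenever `e` does.
-/

section HasAnnihilatingComplement

variable {S : Type*} [CommSemiring S]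

/-- An element `a` for which the principal ideal `(a)` and the annihilator of `a` are comaximal.
The witnesses make `a * b` and `c` complementary idempotents without any subtraction; in a ring
this is von Neumann regularity of `a`. -/
def HasAnnihilatingComplement (a : S) : Prop := ∃ b c : S, a * c = 0 ∧ a * b + c = 1

theorem hasAnnihilatingComplement_of_sup_annihilator_eq_top {a : S}
    (h : Ideal.span {a} ⊔ (Ideal.span {a}).annihilator = ⊤) : HasAnnihilatingComplement a := by
  obtain ⟨u, hu, c, hc, huc⟩ := Submodule.mem_sup.1 ((Ideal.eq_top_iff_one _).1 h)
  obtain ⟨b, rfl⟩ := Ideal.mem_span_singleton.1 hu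
  exact ⟨b, c, (mul_comm a c).trans ((Submodule.mem_annihilator_span_singleton a c).1 hc), huc⟩

theorem eq_sq_mul_of_mul_eq_zero_of_add_eq_one {a b c : S} (hac : a * c = 0)
    (habc : a * b + c = 1) : a = a ^ 2 * b := by
  calc a = a * (a * b + c) := by rw [habc, mul_one]
    _ = a ^ 2 * b := by rw [mul_add, hac, add_zero, sq, mul_assoc]

theorem hasAnnihilatingComplement_of_eq_sq_mul
    (hS : ∀ e : S, IsIdempotentElem e → ∃ f, e * f = 0 ∧ e + f = 1) {a b : S}
    (hab : a = a ^ 2 * b) : HasAnnihilatingComplement a := by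
  have he : IsIdempotentElem (a * b) := by
    calc a * b * (a * b) = a ^ 2 * b * b := by ring
      _ = a * b := by rw [← hab]
  obtain ⟨f, hef, hf⟩ := hS _ he
  refine ⟨b, f, ?_, hf⟩
  calc a * f = a ^ 2 * b * f := by rw [← hab]
    _ = a * (a * b * f) := by ring
    _ = 0 := by rw [hef, mul_zero]

theorem isRegularSemiring_iff_forall_hasAnnihilatingComplement
    (hS : ∀ e : S, IsIdempotentElem e → ∃ f, e * f = 0 ∧ e + f = 1) :
    IsRegularSemiring S ↔ ∀ a : S, HasAnnihilatingComplement a :=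
  ⟨fun h a => (h a).elim fun _ hab => hasAnnihilatingComplement_of_eq_sq_mul hS hab,
    fun h a => (h a).imp fun _ ⟨_, hac, habc⟩ => eq_sq_mul_of_mul_eq_zero_of_add_eq_one hac habc⟩

end HasAnnihilatingComplement

section JoyalSupport

variable {S L : Type*} [CommSemiring S]

/-- A support in the sense of Joyal: the algebraic axioms of `IsSupport`, without generation and
without the condition on radicals. It is shared by supports and by `a ↦ √(a)`, whose values need not
generate the lattice of radical ideals. -/
structure IsJoyalSupport [Lattice L] [BoundedOrder L] (f : S → L) : Prop where
  map_zero : f 0 = ⊥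
  map_one : f 1 = ⊤
  map_add_le : ∀ a b : S, f (a + b) ≤ f a ⊔ f b
  map_mul : ∀ a b : S, f (a * b) = f a ⊓ f b

theorem IsJoyalSupport.isComplemented [Lattice L] [BoundedOrder L] {f : S → L}
    (hf : IsJoyalSupport f) {a : S} (ha : HasAnnihilatingComplement a) : IsComplemented (f a) := by
  obtain ⟨b, c, hac, habc⟩ := ha
  refine ⟨f c, disjoint_iff.2 ?_, codisjoint_iff.2 (top_unique ?_)⟩
  · rw [← hf.map_mul, hac, hf.map_zero]
  · calc ⊤ = f (a * b + c) := by rw [habc, hf.map_one]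
      _ ≤ f (a * b) ⊔ f c := hf.map_add_le _ _
      _ ≤ f a ⊔ f c := sup_le_sup_right ((hf.map_mul a b).trans_le inf_le_left) _

end JoyalSupport

namespace IsSupport

variable {S L : Type*} [CommSemiring S] [DistribLattice L] [BoundedOrder L] {D : S → L}

theorem isJoyalSupport (hD : IsSupport D) : IsJoyalSupport D :=
  ⟨hD.map_zero, hD.map_one, hD.map_add_le, hD.map_mul⟩

theorem induction_on (hD : IsSupport D) {p : L → Prop} (x : L) (map : ∀ a, p (D a))
    (sup : ∀ x y, p x → p y → p (x ⊔ y)) (inf : ∀ x y, p x → p y → p (x ⊓ y)) : p x := by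
  let M : Sublattice L :=
    { carrier := {y | p y}
      supClosed' := fun y hy z hz => sup y z hy hz
      infClosed' := fun y hy z hz => inf y z hy hz }
  have hM : M = ⊤ := hD.generates M map
  exact (hM ▸ Sublattice.mem_top x : x ∈ M)

theorem exists_eq_finset_sup (hD : IsSupport D) (x : L) : ∃ t : Finset S, x = t.sup D := by
  classical
  induction x using hD.induction_on with
  | map a => exact ⟨{a}, Finset.sup_singleton.symm⟩
  | sup x y hx hy =>
    obtain ⟨⟨s, rfl⟩, ⟨t, rfl⟩⟩ := And.intro hx hy
    exact ⟨s ∪ t, Finset.sup_union.symm⟩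
  | inf x y hx hy =>
    obtain ⟨⟨s, rfl⟩, ⟨t, rfl⟩⟩ := And.intro hx hy
    refine ⟨(s ×ˢ t).image fun p => p.1 * p.2, ?_⟩
    rw [Finset.sup_inf_sup, Finset.sup_image]
    exact Finset.sup_congr rfl fun p _ => (hD.map_mul _ _).symm

theorem complementedLattice (hD : IsSupport D) (h : ∀ a, IsComplemented (D a)) :
    ComplementedLattice L :=
  ⟨fun x => hD.induction_on x h (fun _ _ => .sup) (fun _ _ => .inf)⟩

theorem eq_zero_of_map_eq_bot [IsReduced S] (hD : IsSupport D) {a : S} (ha : D a = ⊥) :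
    a = 0 := by
  have hrad : a ∈ (Ideal.span ((∅ : Finset S) : Set S)).radical := hD.mem_radical a ∅ ha.le
  simpa [Ideal.radical_bot_of_isReduced] using hrad

theorem span_eq_top_of_sup_eq_top (hD : IsSupport D) {t : Finset S} (ht : t.sup D = ⊤) :
    Ideal.span (t : Set S) = ⊤ :=
  Ideal.radical_eq_top.1 ((Ideal.eq_top_iff_one _).2 (hD.mem_radical 1 t (ht ▸ le_top)))

theorem hasAnnihilatingComplement [IsReduced S] (hD : IsSupport D) {a : S}
    (ha : IsComplemented (D a)) : HasAnnihilatingComplement a := by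
  classical
  obtain ⟨y, hy⟩ := ha
  obtain ⟨t, rfl⟩ := hD.exists_eq_finset_sup y
  have hann : Ideal.span (t : Set S) ≤ (Ideal.span {a}).annihilator := by
    refine Ideal.span_le.2 fun b hb => (Submodule.mem_annihilator_span_singleton a b).2 ?_
    refine hD.eq_zero_of_map_eq_bot ?_
    rw [smul_eq_mul, hD.map_mul, ← disjoint_iff]
    exact hy.disjoint.symm.mono_left (Finset.le_sup hb)
  have htop : Ideal.span ((insert a t : Finset S) : Set S) = ⊤ :=
    hD.span_eq_top_of_sup_eq_top (by rw [Finset.sup_insert, hy.sup_eq_top])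
  rw [Finset.coe_insert, Ideal.span_insert] at htop
  exact hasAnnihilatingComplement_of_sup_annihilator_eq_top
    (top_unique (htop.ge.trans (sup_le_sup_left hann _)))

end IsSupport

section PrimeIdeals

variable {S : Type*} [CommSemiring S]

theorem isClopen_basicOpen_of_hasAnnihilatingComplement {a : S}
    (ha : HasAnnihilatingComplement a) :
    IsClopen (PrimeSpectrum.basicOpen a : Set (PrimeSpectrum S)) := by
  obtain ⟨b, c, hac, habc⟩ := ha
  have hzero : a * b * c = 0 := by rw [mul_right_comm, hac, zero_mul]
  refine PrimeSpectrum.isClopen_iff_mul_add.2 ⟨a * b, c, hzero, habc, congrArg _ ?_⟩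
  calc PrimeSpectrum.basicOpen a
      = PrimeSpectrum.basicOpen (a ^ 2 * b) :=
        congrArg _ (eq_sq_mul_of_mul_eq_zero_of_add_eq_one hac habc)
    _ = PrimeSpectrum.basicOpen (a * b) := by
        rw [PrimeSpectrum.basicOpen_mul, PrimeSpectrum.basicOpen_pow a 2 two_pos,
          PrimeSpectrum.basicOpen_mul]

theorem isStoneSpace_primeSpectrum_of_forall_hasAnnihilatingComplement
    (h : ∀ a : S, HasAnnihilatingComplement a) : IsStoneSpace (PrimeSpectrum S) := by
  have hbasis : TopologicalSpace.IsTopologicalBasis {s : Set (PrimeSpectrum S) | IsClopen s} := by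
    refine PrimeSpectrum.isTopologicalBasis_basic_opens.of_isOpen_of_subset
      (fun s hs => hs.isOpen) ?_
    rintro _ ⟨a, rfl⟩
    exact isClopen_basicOpen_of_hasAnnihilatingComplement (h a)
  have := totallySeparatedSpace_of_t0_of_basis_clopen hbasis
  exact ⟨inferInstance, inferInstance, inferInstance⟩

theorem isMaximal_of_t1Space_primeSpectrum [T1Space (PrimeSpectrum S)] (P : Ideal S)
    (hP : P.IsPrime) : P.IsMaximal :=
  (PrimeSpectrum.isClosed_singleton_iff_isMaximal ⟨P, hP⟩).1 isClosed_singleton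

-- The maximal ideal of the local semiring at a minimal prime consists of nilpotent elements.
theorem exists_notMem_mul_eq_zero_of_mem_minimalPrimes [IsReduced S] {P : Ideal S}
    (hP : P ∈ minimalPrimes S) {a : S} (ha : a ∈ P) : ∃ s ∉ P, s * a = 0 := by
  have := hP.isPrime
  have := Ring.KrullDimLE.of_isLocalization P hP (Localization.AtPrime P)
  have hnil : IsNilpotent (algebraMap S (Localization.AtPrime P) a) :=
    Ring.KrullDimLE.isNilpotent_iff_mem_maximalIdeal.2
      ((IsLocalization.AtPrime.to_map_mem_maximal_iff _ P a).2 ha)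
  obtain ⟨n, hn⟩ := hnil
  rw [← map_pow, IsLocalization.map_eq_zero_iff P.primeCompl] at hn
  obtain ⟨⟨s, hs⟩, hsn⟩ := hn
  refine ⟨s, hs, eq_zero_of_pow_eq_zero (n := n + 1) ?_⟩
  calc (s * a) ^ (n + 1) = s * a ^ n * (s ^ n * a) := by ring
    _ = 0 := by rw [hsn, zero_mul]

theorem hasAnnihilatingComplement_of_krullDimLE_zero [IsReduced S] [Ring.KrullDimLE 0 S] (a : S) :
    HasAnnihilatingComplement a := by
  refine hasAnnihilatingComplement_of_sup_annihilator_eq_top ?_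
  by_contra hne
  obtain ⟨M, hM, hle⟩ := Ideal.exists_le_maximal _ hne
  have haM : a ∈ M := hle (Ideal.mem_sup_left (Ideal.mem_span_singleton_self a))
  obtain ⟨s, hsM, hsa⟩ := exists_notMem_mul_eq_zero_of_mem_minimalPrimes
    (Ideal.mem_minimalPrimes_iff_isPrime.2 hM.isPrime) haM
  exact hsM (hle (Ideal.mem_sup_right ((Submodule.mem_annihilator_span_singleton a s).2 hsa)))

end PrimeIdeals

theorem IsZeroDimensionalFrame.isCoatom_of_infPrime {F : Type*} [Order.Frame F]
    (hF : IsZeroDimensionalFrame F) {p : F} (hp : InfPrime p) : IsCoatom p := by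
  refine ⟨fun h => hp.1 (h ▸ isMax_top), fun x hpx => ?_⟩
  obtain ⟨C, hC, rfl⟩ := hF x
  obtain ⟨c, hcC, hcp⟩ : ∃ c ∈ C, ¬ c ≤ p := by
    by_contra! h
    exact hpx.not_ge (sSup_le h)
  obtain ⟨d, hcd⟩ := hC c hcC
  have hdp : d ≤ p := (hp.2 (hcd.inf_eq_bot.trans_le bot_le)).resolve_left hcp
  exact top_unique (hcd.sup_eq_top.ge.trans (sup_le (le_sSup hcC) (hdp.trans hpx.le)))

namespace RId

variable {S : Type*} [CommSemiring S]

/-- The radical of the principal ideal `(a)`, as an element of the frame of radical ideals; these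
elements generate the frame under joins. -/
def principal (a : S) : RId S := ofIdeal (Ideal.span {a})

theorem principal_le_iff {a : S} {I : RId S} : principal a ≤ I ↔ a ∈ I.1 :=
  (gi.gc _ _).trans (Ideal.span_singleton_le_iff_mem _)

theorem sSup_image_principal (I : RId S) : sSup (principal '' (I.1 : Set S)) = I := by
  refine le_antisymm (sSup_le ?_) fun a ha =>
    principal_le_iff.1 (le_sSup (Set.mem_image_of_mem principal ha))
  rintro _ ⟨a, ha, rfl⟩
  exact principal_le_iff.2 ha

theorem isJoyalSupport_principal : IsJoyalSupport (principal : S → RId S) where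
  map_zero := by
    rw [principal, Ideal.span_singleton_eq_bot.2 rfl]
    exact gi.gc.l_bot
  map_one := by
    rw [principal, Ideal.span_singleton_one]
    exact gi.l_top
  map_add_le a b := principal_le_iff.2 <|
    add_mem (principal_le_iff.1 le_sup_left) (principal_le_iff.1 le_sup_right)
  map_mul a b := Subtype.ext <| by
    change (Ideal.span {a * b}).radical = (Ideal.span {a}).radical ⊓ (Ideal.span {b}).radical
    rw [← Ideal.span_singleton_mul_span_singleton, Ideal.radical_mul]

theorem isZeroDimensionalFrame_of_forall_hasAnnihilatingComplement
    (h : ∀ a : S, HasAnnihilatingComplement a) : IsZeroDimensionalFrame (RId S) := by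
  refine fun I => ⟨principal '' (I.1 : Set S), ?_, (sSup_image_principal I).symm⟩
  rintro _ ⟨a, -, rfl⟩
  exact isJoyalSupport_principal.isComplemented (h a)

theorem infPrime_of_isPrime {I : RId S} (hI : I.1.IsPrime) : InfPrime I :=
  ⟨fun hmax => hI.ne_top (top_unique (hmax.isTop ⊤ : (⊤ : RId S).1 ≤ I.1)), fun _ _ => hI.inf_le.1⟩

theorem isMaximal_of_isCoatom {I : RId S} (hI : IsCoatom I) : I.1.IsMaximal := by
  refine ⟨⟨fun htop => hI.1 (Subtype.ext htop), fun J hJ => Ideal.radical_eq_top.1 ?_⟩⟩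
  have hlt : I < ofIdeal J := hJ.trans_le Ideal.le_radical
  exact congrArg Subtype.val (hI.2 _ hlt)

end RId

theorem IsZeroDimensionalFrame.isMaximal_of_isPrime {S : Type*} [CommSemiring S]
    (h : IsZeroDimensionalFrame (RId S)) (P : Ideal S) (hP : P.IsPrime) : P.IsMaximal :=
  RId.isMaximal_of_isCoatom
    (h.isCoatom_of_infPrime (RId.infPrime_of_isPrime (I := ⟨P, hP.isRadical⟩) hP))

section FRing

variable {R : Type*} [CommRing R] [Lattice R] [IsFRing R]

theorem IsFRing.posPart_mul_negPart_nonpos (a : R) : a⁺ * a⁻ ≤ 0 := by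
  have hp : 0 ≤ a⁺ := posPart_nonneg a
  have hn : 0 ≤ a⁻ := negPart_nonneg a
  calc a⁺ * a⁻ ≤ a⁺ * (a⁺ + a⁻) ⊓ a⁻ * (a⁺ + a⁻) :=
        le_inf (mul_le_mul_of_nonneg_left (le_add_of_nonneg_left hp) hp) <|
          (mul_comm _ _).trans_le (mul_le_mul_of_nonneg_left (le_add_of_nonneg_right hn) hn)
    _ = (a⁺ ⊓ a⁻) * (a⁺ + a⁻) := (IsFRing.inf_mul_of_nonneg _ _ _ (add_nonneg hp hn)).symm
    _ = 0 := by rw [posPart_inf_negPart_eq_zero, zero_mul]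

theorem IsFRing.mul_self_nonneg (a : R) : 0 ≤ a * a := by
  have hpp : 0 ≤ a⁺ * a⁺ := mul_nonneg (posPart_nonneg a) (posPart_nonneg a)
  have hnn : 0 ≤ a⁻ * a⁻ := mul_nonneg (negPart_nonneg a) (negPart_nonneg a)
  have hpn : 0 ≤ -(a⁺ * a⁻) := neg_nonneg.2 (IsFRing.posPart_mul_negPart_nonpos a)
  calc (0 : R) ≤ a⁺ * a⁺ + a⁻ * a⁻ + (-(a⁺ * a⁻) + -(a⁺ * a⁻)) :=
        add_nonneg (add_nonneg hpp hnn) (add_nonneg hpn hpn)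
    _ = (a⁺ - a⁻) * (a⁺ - a⁻) := by ring
    _ = a * a := by rw [posPart_sub_negPart]

theorem IsFRing.le_one_of_isIdempotentElem {e : R} (he : IsIdempotentElem e) : e ≤ 1 :=
  sub_nonneg.1 (he.one_sub.eq ▸ IsFRing.mul_self_nonneg (1 - e))

theorem PositiveCone.exists_mul_eq_zero_add_eq_one (e : PositiveCone R)
    (he : IsIdempotentElem e) : ∃ f, e * f = 0 ∧ e + f = 1 := by
  have he' : IsIdempotentElem (e : R) := congrArg Subtype.val he
  exact ⟨⟨1 - e, sub_nonneg.2 (IsFRing.le_one_of_isIdempotentElem he')⟩,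
    Subtype.ext he'.mul_one_sub_self, Subtype.ext (add_sub_cancel (e : R) 1)⟩

end FRing

theorem theorem4_general {S : Type*} [CommSemiring S] [IsReduced S]
    (hS : ∀ e : S, IsIdempotentElem e → ∃ f, e * f = 0 ∧ e + f = 1)
    {L : Type*} [DistribLattice L] [BoundedOrder L] (D : S → L) (hD : IsSupport D) :
    List.TFAE [
      IsStoneSpace (PrimeSpectrum S),
      ComplementedLattice L,
      IsRegularSemiring S,
      IsZeroDimensionalFrame (RId S),
      ∀ P : Ideal S, P.IsPrime → P.IsMaximal] := by
  rw [isRegularSemiring_iff_forall_hasAnnihilatingComplement hS]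
  tfae_have 3 → 1 := isStoneSpace_primeSpectrum_of_forall_hasAnnihilatingComplement
  tfae_have 1 → 5 := fun ⟨_, _, _⟩ => isMaximal_of_t1Space_primeSpectrum
  tfae_have 5 → 3 := fun h =>
    have : Ring.KrullDimLE 0 S := .mk₀ h
    hasAnnihilatingComplement_of_krullDimLE_zero
  tfae_have 3 → 4 := RId.isZeroDimensionalFrame_of_forall_hasAnnihilatingComplement
  tfae_have 4 → 5 := fun h => h.isMaximal_of_isPrime
  tfae_have 3 → 2 := fun h =>
    hD.complementedLattice fun a => hD.isJoyalSupport.isComplemented (h a)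
  tfae_have 2 → 3 := fun h a => hD.hasAnnihilatingComplement (h.exists_isCompl (D a))
  tfae_finish

theorem theorem4 {R : Type*} [CommRing R] [Lattice R] [IsFRing R] [IsReduced (PositiveCone R)]
    {L : Type*} [DistribLattice L] [BoundedOrder L] (D : PositiveCone R → L)
    (hD : IsSupport D) :
    List.TFAE [
      IsStoneSpace (PrimeSpectrum (PositiveCone R)),
      ComplementedLattice L,
      IsRegularSemiring (PositiveCone R),
      IsZeroDimensionalFrame (RId (PositiveCone R)),
      ∀ P : Ideal (PositiveCone R), P.IsPrime → P.IsMaximal] :=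
  theorem4_general PositiveCone.exists_mul_eq_zero_add_eq_one D hD
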